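/- Let $V$ be a finite set, $I\subseteq\mathbb{R}$ an interval and $\mathsf H:I\to\mathbb{C}^{V\times V}$ a continuous matrix-valued function. Let $\mathcal G$ be the directed graph on $V$ with an edge $\alpha\to\beta$ iff $\mathsf H_{\beta\alpha}(t)\neq0$ for some $t\in I$, and for $S\subseteq V$ let $\mathcal G\backslash S$ be the subgraph obtained by removing the vertices in $S$. A simple path is a walk whose vertices are all distinct (the path $(\alpha)$ of length $0$ included); a simple cycle from $\alpha$ to itself is a walk of length at least $1$ from $\alpha$ to $\alpha$ whose intermediate vertices are distinct and different from $\alpha$ (self-loops included). Let $\Pi_{\mathcal G;\alpha\omega}$ be the (finite) set of simple paths from $\alpha$ to $\omega$ on $\mathcal G$, and $\Gamma_{\mathcal G;\alpha}$ the (finite) set of simple cycles from $\alpha$ to itself on $\mathcal G$. Consider scalar kernels $k(t',t)=c\,\delta(t'-t)+k_0(t',t)$ on $I^2$ with $c\in\mathbb{C}$ and $k_0$ continuous, with the product $(k\ast l)(t',t)=\int_t^{t'}k(t',\tau)\,l(\tau,t)\,d\tau$, for which $1_\ast:=\delta(t'-t)$ is the identity; $\ast$-inverses are two-sided inverses among these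 kernels, and $\int_t^{t'}\delta(t'-\tau)\,d\tau:=1$. In products, the entry $\mathsf H_{\beta\alpha}$ stands for the kernel $(t',t)\mapsto\mathsf H_{\beta\alpha}(t)$. **Theorem.** The time-ordered exponential of $\mathsf H$ exists, that is, there is $\mathsf{OE}[\mathsf H]:I^2\to\mathbb{C}^{V\times V}$ with $\frac{d}{dt'}\mathsf{OE}[\mathsf H](t',t)=\mathsf H(t')\,\mathsf{OE}[\mathsf H](t',t)$ and $\mathsf{OE}[\mathsf H](t,t)=\mathrm{Id}$ for all $t,t'\in I$. For all $\alpha,\omega\in V$ and all $t,t'\in I$, every such function satisfies $$\mathsf{OE}_{\omega\alpha}[\mathsf H](t',t)=\sum_{p\in\Pi_{\mathcal G;\alpha\omega}}\int_t^{t'}\Big(\mathsf G_{\mathcal G\backslash\{\alpha,\nu_1,\dots,\nu_{\ell-1}\};\,\omega}\ast\mathsf H_{\omega\nu_{\ell-1}}\ast\cdots\ast\mathsf H_{\nu_2\nu_1}\ast\mathsf G_{\mathcal G\backslash\{\alpha\};\,\nu_1}\ast\mathsf H_{\nu_1\alpha}\ast\mathsf G_{\mathcal G;\,\alpha}\Big)(t',\tau)\,d\tau,$$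 where $p=(\alpha,\nu_1,\dots,\nu_{\ell-1},\omega)$ has length $\ell$ (for $\omega=\alpha$ the only term is $\int_t^{t'}\mathsf G_{\mathcal G;\alpha}(t',\tau)\,d\tau$). Here the Green's kernels are determined, by recursion on the number of vertices, as follows: for every $\mathcal G'=\mathcal G\backslash S$ and every vertex $\alpha$ of $\mathcal G'$, the $\ast$-inverse $$\mathsf G_{\mathcal G';\,\alpha}=\Big[1_\ast-\sum_{\gamma\in\Gamma_{\mathcal G';\alpha}}\mathsf H_{\alpha\mu_{m-1}}\ast\mathsf G_{\mathcal G'\backslash\{\alpha,\mu_1,\dots,\mu_{m-2}\};\,\mu_{m-1}}\ast\cdots\ast\mathsf H_{\mu_2\mu_1}\ast\mathsf G_{\mathcal G'\backslash\{\alpha\};\,\mu_1}\ast\mathsf H_{\mu_1\alpha}\Big]^{\ast-1}$$ exists and is unique, where $\gamma=(\alpha,\mu_1,\dots,\mu_{m-1},\alpha)$ has length $m$ (a self-loop, $m=1$, contributes $\mathsf H_{\alpha\alpha}$). Each recursion step removes at least one vertex and every sum is finite, so each entry of $\mathsf{OE}[\mathsf H]$ is a branched continued fraction of $\ast$-inverses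 of finite depth and breadth. -/

import Mathlib

open scoped Matrix

noncomputable section

namespace PathSum

/-! ### Kernels in two time variables and the star product -/

/-- A scalar kernel `c • δ(s - t) + k(s, t)`, stored as the pair `(c, k)`; the first time argument
of `k` is the later one in the ordering of products (the row time index). -/
def StarKernel : Type := ℂ × (ℝ → ℝ → ℂ)

namespace StarKernel

/-- The coefficient of the Dirac delta `δ(s - t)`. -/
def delta (k : StarKernel) : ℂ := k.1

/-- The ordinary function part of the kernel. -/
def fn (k : StarKernel) : ℝ → ℝ → ℂ := k.2

/-- Addition and subtraction of kernels are componentwise. -/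
instance : AddCommGroup StarKernel := inferInstanceAs (AddCommGroup (ℂ × (ℝ → ℝ → ℂ)))

/-- The star identity `1_* = δ(s - t)`. -/
instance : One StarKernel := ⟨((1 : ℂ), fun _ _ => (0 : ℂ))⟩

/-- The star product `(k * l)(s, t) = ∫ τ in t..s, k(s, τ) l(τ, t)`, with `δ(s - t)` acting as a
two-sided identity. -/
instance : Mul StarKernel :=
  ⟨fun k l => (k.delta * l.delta, fun s t =>
    k.delta * l.fn s t + k.fn s t * l.delta + ∫ τ in t..s, k.fn s τ * l.fn τ t)⟩

/-- The integral of `k(s, τ)` over `τ` from `t` to `s`; the Dirac delta at the end point `s`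
contributes with weight one (the convention `Θ(0) = 1` for the Heaviside function). -/
def integral (k : StarKernel) (s t : ℝ) : ℂ := k.delta + ∫ τ in t..s, k.fn s τ

/-- Equality of two kernels for all times in `I`. -/
def EqOn (I : Set ℝ) (k l : StarKernel) : Prop :=
  k.delta = l.delta ∧ ∀ s ∈ I, ∀ t ∈ I, k.fn s t = l.fn s t

/-- `g` is a (two-sided) star inverse of `k` on `I`, with continuous function part. -/
def IsStarInverse (I : Set ℝ) (k g : StarKernel) : Prop :=
  ContinuousOn (fun q : ℝ × ℝ => g.fn q.1 q.2) (I ×ˢ I) ∧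
    EqOn I (k * g) 1 ∧ EqOn I (g * k) 1

open Classical in
/-- The star inverse of `k` on `I` (zero if there is none). -/
def starInv (I : Set ℝ) (k : StarKernel) : StarKernel :=
  if h : ∃ g, IsStarInverse I k g then h.choose else 0

end StarKernel

/-! ### Simple paths and simple cycles -/

section Graph

variable {V : Type*}

/-- `p`, the list of the visited vertices in order, is a simple path from `α` to `ω` on the
subgraph of `G` induced on the vertex set `W`. -/
def IsSimplePath (G : Digraph V) (W : Finset V) (α ω : V) (p : List V) : Prop :=
  p.head? = some α ∧ p.getLast? = some ω ∧ p.Nodup ∧ (∀ v ∈ p, v ∈ W) ∧ p.IsChain G.Adj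

/-- `μ = [μ₁, …, μ_{m-1}]` is the list of the intermediate vertices of a simple cycle
`(α, μ₁, …, μ_{m-1}, α)` of length `m ≥ 1` on the subgraph of `G` induced on the vertex
set `W`. The empty list stands for the self-loop `(α, α)`. -/
def IsSimpleCycle (G : Digraph V) (W : Finset V) (α : V) (μ : List V) : Prop :=
  μ.Nodup ∧ α ∉ μ ∧ (∀ v ∈ α :: μ, v ∈ W) ∧ (α :: (μ ++ [α])).IsChain G.Adj

variable [Fintype V]

theorem finite_of_nodup (P : List V → Prop) (h : ∀ l, P l → l.Nodup) : {l | P l}.Finite := by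
  classical
  exact Set.Finite.subset (s := {l : List V | l.Nodup})
    (Set.finite_coe_iff.mp (Finite.of_fintype {l : List V // l.Nodup})) fun l hl => h l hl

/-- The finite set of simple paths from `α` to `ω` on the subgraph induced on `W`. -/
def simplePaths (G : Digraph V) (W : Finset V) (α ω : V) : Finset (List V) :=
  (finite_of_nodup (IsSimplePath G W α ω) fun _ h => h.2.2.1).toFinset

/-- The finite set of simple cycles from `α` to itself on the subgraph induced on `W`. -/
def simpleCycles (G : Digraph V) (W : Finset V) (α : V) : Finset (List V) :=
  (finite_of_nodup (IsSimpleCycle G W α) fun _ h => h.1).toFinset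

end Graph

/-! ### Time-dependent matrices, Green kernels and path weights -/

section Matrices

variable {V : Type*}

/-- `U s t` is the time-ordered exponential of `H` on `I`: it solves
`d/ds U(s, t) = H(s) U(s, t)` and equals the identity at `s = t`. -/
def IsTimeOrderedExp [Fintype V] [DecidableEq V] (I : Set ℝ) (H : ℝ → Matrix V V ℂ)
    (U : ℝ → ℝ → Matrix V V ℂ) : Prop :=
  ∀ t ∈ I, U t t = 1 ∧ ∀ s ∈ I, ∀ i j : V,
    HasDerivWithinAt (fun r => U r t i j) ((H s * U s t) i j) I s

/-- The graph of `H`: there is an edge from `α` to `β` iff `H β α` is not identically zero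
on `I`. -/
def graph (I : Set ℝ) (H : ℝ → Matrix V V ℂ) : Digraph V :=
  ⟨fun α β => ∃ t ∈ I, H t β α ≠ 0⟩

/-- The weight `H_{βα}` of the edge from `α` to `β`, as the kernel `(s, t) ↦ H_{βα}(t)`. -/
def edge (H : ℝ → Matrix V V ℂ) (β α : V) : StarKernel :=
  ((0 : ℂ), fun _ t => H t β α)

variable [DecidableEq V]

/-- For `p = [α, ν₁, …, ν_{m-1}, ω]`, and `g W ν` the kernel attached to a vertex `ν` of the
subgraph induced on `W`, the star product
`g (W \ {α, ν₁, …, ν_{m-1}}) ω * H_{ων_{m-1}} * ⋯ * g (W \ {α}) ν₁ * H_{ν₁α} * g W α`. -/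
def pathWeight (H : ℝ → Matrix V V ℂ) (g : Finset V → V → StarKernel) :
    Finset V → List V → StarKernel
  | _, [] => 1
  | W, [ω] => g W ω
  | W, α :: ν :: p => pathWeight H g (W.erase α) (ν :: p) * edge H ν α * g W α

/-- The weight of the simple cycle `(α, μ₁, …, μ_{m-1}, α)`: the star product
`H_{αμ_{m-1}} * g (W \ {α, μ₁, …, μ_{m-2}}) μ_{m-1} * ⋯ * g (W \ {α}) μ₁ * H_{μ₁α}`,
and `H_{αα}` for the self-loop. -/
def cycleWeight (H : ℝ → Matrix V V ℂ) (g : Finset V → V → StarKernel)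
    (W : Finset V) (α : V) : List V → StarKernel
  | [] => edge H α α
  | μ₁ :: μ =>
    edge H α ((μ₁ :: μ).getLast (List.cons_ne_nil μ₁ μ)) *
      pathWeight H g (W.erase α) (μ₁ :: μ) * edge H μ₁ α

variable [Fintype V]

/-- `1_* - ∑ (weights of the simple cycles from α to itself)` on the subgraph induced on `W`. -/
def greenDenom (I : Set ℝ) (H : ℝ → Matrix V V ℂ) (g : Finset V → V → StarKernel)
    (W : Finset V) (α : V) : StarKernel :=
  1 - ∑ μ ∈ simpleCycles (graph I H) W α, cycleWeight H g W α μ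

/-- The Green kernel at `α` on the subgraph induced on `W` (`W` being the set of vertices that
have not been removed), by recursion on the number of vertices. For `α ∈ W`, the kernels used on
the right-hand side are those of proper subsets of `W` only. -/
def green (I : Set ℝ) (H : ℝ → Matrix V V ℂ) (W : Finset V) (α : V) : StarKernel :=
  StarKernel.starInv I
    (greenDenom I H (fun W₁ β => if _ : W₁ ⊂ W then green I H W₁ β else 0) W α)
termination_by W.card
decreasing_by exact Finset.card_lt_card (by assumption)

end Matrices

end PathSum

end

noncomputable section

namespace PathSum

open Set Filter Topology MeasureTheory

/-! ### Continuous functions of two variables on an interval -/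

/-! Kernels with continuous function part, taken up to equality on `I × I`, form a noncommutative
ring under the star product (`KernelRing`). Let `E` be the matrix over this ring whose entries are
the edge kernels. Formally the time-ordered exponential is the integral of `(1 - E)⁻¹`, and path
sums compute this inverse by eliminating one vertex at a time.

The algebra holds in any ring. Removing `α` from `W` splits the matrix into blocks. A simple cycle
at `α` is a self-loop, or an edge out, a simple path on `W \ {α}` and an edge back, so the
denominator at `α` is the Schur complement of the block `W \ {α}` (`cycleSum_eq`). A nontrivial
simple path from `α` is an edge followed by a simple path on `W \ {α}` (`pathSum_of_ne`). Induction
on `W` then gives `R = 1 + E R` for the matrix `R` of path sums (`pathSum_eq_add_sum`).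

The analysis enters twice. Each denominator has delta coefficient one, hence is invertible by a
Volterra series whose terms decay factorially (`exists_inverse`). Multiplying `R = 1 + E R` on the
right by the constant kernel `theta` gives the integral form of the differential equation; so the
integrated path sums solve it, and uniqueness for linear equations identifies them with any
time-ordered exponential. -/

theorem exists_continuous_eqOn_Icc {a b : ℝ} (hab : a ≤ b) {f : ℝ → ℝ → ℂ}
    (hf : ContinuousOn (fun q : ℝ × ℝ => f q.1 q.2) (Icc a b ×ˢ Icc a b)) :
    ∃ g : ℝ → ℝ → ℂ, Continuous (fun q : ℝ × ℝ => g q.1 q.2) ∧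
      ∀ s ∈ Icc a b, ∀ t ∈ Icc a b, f s t = g s t := by
  -- Clamping both variables to the interval gives a global extension, to which results on globally
  -- continuous integrands apply.
  refine ⟨fun s t => f (projIcc a b hab s) (projIcc a b hab t), ?_, fun s hs t ht => ?_⟩
  · refine hf.comp_continuous (f := fun q : ℝ × ℝ =>
      ((projIcc a b hab q.1 : ℝ), (projIcc a b hab q.2 : ℝ))) ?_ fun q => ?_
    · exact (continuous_subtype_val.comp (continuous_projIcc.comp continuous_fst)).prodMk
        (continuous_subtype_val.comp (continuous_projIcc.comp continuous_snd))
    · exact ⟨(projIcc a b hab q.1).2, (projIcc a b hab q.2).2⟩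
  · simp [projIcc_of_mem hab hs, projIcc_of_mem hab ht]

/-- On a side where `I` has no further point, `s` itself serves as the end point. Local questions on
any kind of interval, end points included, thus reduce to compact intervals. -/
theorem exists_Icc_mem_nhdsWithin {I : Set ℝ} {s : ℝ} (hs : s ∈ I) :
    ∃ a ∈ I, ∃ b ∈ I, a ≤ s ∧ s ≤ b ∧ Icc a b ∈ 𝓝[I] s := by
  have hl : ∃ a ∈ I, a ≤ s ∧ Ici a ∈ 𝓝[I] s := by
    by_cases h : ∃ a ∈ I, a < s
    · obtain ⟨a, ha, has⟩ := h
      exact ⟨a, ha, has.le, mem_nhdsWithin_of_mem_nhds (Ici_mem_nhds has)⟩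
    · push Not at h
      exact ⟨s, hs, le_rfl, mem_of_superset self_mem_nhdsWithin fun x hx => h x hx⟩
  have hr : ∃ b ∈ I, s ≤ b ∧ Iic b ∈ 𝓝[I] s := by
    by_cases h : ∃ b ∈ I, s < b
    · obtain ⟨b, hb, hbs⟩ := h
      exact ⟨b, hb, hbs.le, mem_nhdsWithin_of_mem_nhds (Iic_mem_nhds hbs)⟩
    · push Not at h
      exact ⟨s, hs, le_rfl, mem_of_superset self_mem_nhdsWithin fun x hx => h x hx⟩
  obtain ⟨a, ha, has, ha'⟩ := hl
  obtain ⟨b, hb, hbs, hb'⟩ := hr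
  exact ⟨a, ha, b, hb, has, hbs, by rw [← Ici_inter_Iic]; exact inter_mem ha' hb'⟩

theorem continuousOn_prod_of_Icc {I : Set ℝ} {f : ℝ × ℝ → ℂ}
    (h : ∀ a ∈ I, ∀ b ∈ I, a ≤ b → ContinuousOn f (Icc a b ×ˢ Icc a b)) :
    ContinuousOn f (I ×ˢ I) := by
  rintro ⟨s, t⟩ ⟨hs, ht⟩
  obtain ⟨a₁, ha₁, b₁, hb₁, has₁, hbs₁, hn₁⟩ := exists_Icc_mem_nhdsWithin hs
  obtain ⟨a₂, ha₂, b₂, hb₂, has₂, hbs₂, hn₂⟩ := exists_Icc_mem_nhdsWithin ht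
  have ha : min a₁ a₂ ∈ I := by rcases min_choice a₁ a₂ with h | h <;> rw [h] <;> assumption
  have hb : max b₁ b₂ ∈ I := by rcases max_choice b₁ b₂ with h | h <;> rw [h] <;> assumption
  have h₁ : Icc (min a₁ a₂) (max b₁ b₂) ∈ 𝓝[I] s :=
    mem_of_superset hn₁ (Icc_subset_Icc (min_le_left _ _) (le_max_left _ _))
  have h₂ : Icc (min a₁ a₂) (max b₁ b₂) ∈ 𝓝[I] t :=
    mem_of_superset hn₂ (Icc_subset_Icc (min_le_right _ _) (le_max_right _ _))
  have hab : min a₁ a₂ ≤ max b₁ b₂ :=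
    (min_le_left _ _).trans (has₁.trans (hbs₁.trans (le_max_left _ _)))
  have hp : Icc (min a₁ a₂) (max b₁ b₂) ×ˢ Icc (min a₁ a₂) (max b₁ b₂) ∈ 𝓝[I ×ˢ I] (s, t) := by
    rw [nhdsWithin_prod_eq]
    exact prod_mem_prod h₁ h₂
  exact (h _ ha _ hb hab (s, t) ⟨mem_of_mem_nhdsWithin hs h₁, mem_of_mem_nhdsWithin ht h₂⟩)
    |>.mono_of_mem_nhdsWithin hp

theorem continuousOn_convolution {I : Set ℝ} (hI : I.OrdConnected) {k l : ℝ → ℝ → ℂ}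
    (hk : ContinuousOn (fun q : ℝ × ℝ => k q.1 q.2) (I ×ˢ I))
    (hl : ContinuousOn (fun q : ℝ × ℝ => l q.1 q.2) (I ×ˢ I)) :
    ContinuousOn (fun q : ℝ × ℝ => ∫ τ in q.2..q.1, k q.1 τ * l τ q.2) (I ×ˢ I) := by
  refine continuousOn_prod_of_Icc fun a ha b hb hab => ?_
  have hsub : Icc a b ⊆ I := hI.out ha hb
  obtain ⟨k', hk', hkk⟩ := exists_continuous_eqOn_Icc hab (hk.mono (prod_mono hsub hsub))
  obtain ⟨l', hl', hll⟩ := exists_continuous_eqOn_Icc hab (hl.mono (prod_mono hsub hsub))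
  have hF : Continuous (Function.uncurry fun (q : ℝ × ℝ) (τ : ℝ) => k' q.1 τ * l' τ q.2) :=
    (hk'.comp (g := fun q : ℝ × ℝ => k' q.1 q.2)
      (f := fun q : (ℝ × ℝ) × ℝ => (q.1.1, q.2)) (by fun_prop)).mul
    (hl'.comp (g := fun q : ℝ × ℝ => l' q.1 q.2)
      (f := fun q : (ℝ × ℝ) × ℝ => (q.2, q.1.2)) (by fun_prop))
  have hc : Continuous fun q : ℝ × ℝ => ∫ τ in q.2..q.1, k' q.1 τ * l' τ q.2 := by
    -- Both limits vary, so the integral is written as a difference of two integrals with fixed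
    -- lower limit `0`.
    have h := (intervalIntegral.continuous_parametric_intervalIntegral_of_continuous
      (μ := volume) (a₀ := 0) hF continuous_fst).sub
      (intervalIntegral.continuous_parametric_intervalIntegral_of_continuous
      (μ := volume) (a₀ := 0) hF continuous_snd)
    refine h.congr fun q => ?_
    have hq : Continuous fun τ => k' q.1 τ * l' τ q.2 :=
      hF.comp (f := fun τ : ℝ => (q, τ)) (by fun_prop)
    exact intervalIntegral.integral_interval_sub_left (hq.intervalIntegrable _ _)
      (hq.intervalIntegrable _ _)
  refine hc.continuousOn.congr ?_
  rintro ⟨s, t⟩ ⟨hs, ht⟩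
  refine intervalIntegral.integral_congr fun τ hτ => ?_
  have hτ' : τ ∈ Icc a b := ordConnected_Icc.uIcc_subset ht hs hτ
  simp only [hkk s hs τ hτ', hll τ hτ' t ht]

theorem intervalIntegrable_mul {I : Set ℝ} (hI : I.OrdConnected) {k l : ℝ → ℝ → ℂ}
    (hk : ContinuousOn (fun q : ℝ × ℝ => k q.1 q.2) (I ×ˢ I))
    (hl : ContinuousOn (fun q : ℝ × ℝ => l q.1 q.2) (I ×ˢ I))
    {s t u v : ℝ} (hs : s ∈ I) (ht : t ∈ I) (hu : u ∈ I) (hv : v ∈ I) :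
    IntervalIntegrable (fun τ => k s τ * l τ t) volume u v := by
  have hsub := hI.uIcc_subset hu hv
  refine ContinuousOn.intervalIntegrable (ContinuousOn.mul ?_ ?_)
  · exact hk.comp (f := fun τ : ℝ => (s, τ)) (by fun_prop) fun τ hτ => ⟨hs, hsub hτ⟩
  · exact hl.comp (f := fun τ : ℝ => (τ, t)) (by fun_prop) fun τ hτ => ⟨hsub hτ, ht⟩

/-! ### Fubini on a triangle -/

theorem integral_triangle_swap_of_le {F : ℝ → ℝ → ℂ} (hF : Continuous (fun q : ℝ × ℝ => F q.1 q.2))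
    {a b : ℝ} (hab : a ≤ b) :
    ∫ τ in a..b, ∫ σ in τ..b, F σ τ = ∫ σ in a..b, ∫ τ in a..σ, F σ τ := by
  have hint : Integrable (Function.uncurry fun τ σ => if τ < σ then F σ τ else 0)
      ((volume.restrict (Ioc a b)).prod (volume.restrict (Ioc a b))) := by
    rw [Measure.prod_restrict, ← Measure.volume_eq_prod]
    have h1 : IntegrableOn (fun q : ℝ × ℝ => F q.2 q.1) (Ioc a b ×ˢ Ioc a b) := by
      refine IntegrableOn.mono_set (t := Icc a b ×ˢ Icc a b) ?_
        (prod_mono Ioc_subset_Icc_self Ioc_subset_Icc_self)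
      exact (hF.comp continuous_swap).continuousOn.integrableOn_compact
        (isCompact_Icc.prod isCompact_Icc)
    have h2 := Integrable.indicator h1
      (measurableSet_lt measurable_fst measurable_snd : MeasurableSet {q : ℝ × ℝ | q.1 < q.2})
    refine h2.congr (ae_of_all _ fun q => ?_)
    by_cases h : q.1 < q.2 <;> simp [Function.uncurry, indicator, h]
  have hswap := integral_integral_swap hint
  rw [intervalIntegral.integral_of_le hab, intervalIntegral.integral_of_le hab]
  convert hswap using 1
  · refine setIntegral_congr_fun measurableSet_Ioc fun τ hτ => ?_
    rw [intervalIntegral.integral_of_le hτ.2]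
    have : (fun σ => if τ < σ then F σ τ else 0) = (Ioi τ).indicator (fun σ => F σ τ) := by
      ext σ; simp [indicator]
    rw [this, setIntegral_indicator measurableSet_Ioi]
    congr 2
    ext σ
    simp only [mem_Ioc, mem_inter_iff, mem_Ioi]
    exact ⟨fun h => ⟨⟨hτ.1.trans h.1, h.2⟩, h.1⟩, fun h => ⟨h.2, h.1.2⟩⟩
  · refine setIntegral_congr_fun measurableSet_Ioc fun σ hσ => ?_
    rw [intervalIntegral.integral_of_le hσ.1.le, integral_Ioc_eq_integral_Ioo]
    have : (fun τ => if τ < σ then F σ τ else 0) = (Iio σ).indicator (fun τ => F σ τ) := by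
      ext τ; simp [indicator]
    rw [this, setIntegral_indicator measurableSet_Iio]
    congr 2
    ext τ
    simp only [mem_Ioc, mem_Ioo, mem_inter_iff, mem_Iio]
    exact ⟨fun h => ⟨⟨h.1, (h.2.trans_le hσ.2).le⟩, h.2⟩, fun h => ⟨h.1.1, h.2⟩⟩

theorem integral_triangle_swap {F : ℝ → ℝ → ℂ} (hF : Continuous (fun q : ℝ × ℝ => F q.1 q.2))
    (a b : ℝ) :
    ∫ τ in a..b, ∫ σ in τ..b, F σ τ = ∫ σ in a..b, ∫ τ in a..σ, F σ τ := by
  rcases le_total a b with hab | hab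
  · exact integral_triangle_swap_of_le hF hab
  · have h := integral_triangle_swap_of_le (F := fun σ τ => F τ σ)
      (hF.comp continuous_swap) hab
    have h1 : ∀ τ, ∫ σ in τ..b, F σ τ = -∫ σ in b..τ, F σ τ :=
      fun τ => intervalIntegral.integral_symm _ _
    have h2 : ∀ σ, ∫ τ in a..σ, F σ τ = -∫ τ in σ..a, F σ τ :=
      fun τ => intervalIntegral.integral_symm _ _
    simp_rw [h1, h2]
    rw [intervalIntegral.integral_symm b a, intervalIntegral.integral_symm b a,
      intervalIntegral.integral_neg, intervalIntegral.integral_neg, h]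

/-! ### Regular kernels -/

namespace StarKernel

variable {I : Set ℝ}

@[simp] theorem delta_mul (k l : StarKernel) : (k * l).delta = k.delta * l.delta := rfl
@[simp] theorem delta_one : (1 : StarKernel).delta = 1 := rfl
@[simp] theorem delta_zero : (0 : StarKernel).delta = 0 := rfl
@[simp] theorem delta_add (k l : StarKernel) : (k + l).delta = k.delta + l.delta := rfl
@[simp] theorem delta_sub (k l : StarKernel) : (k - l).delta = k.delta - l.delta := rfl
@[simp] theorem delta_neg (k : StarKernel) : (-k).delta = -k.delta := rfl
theorem fn_mul (k l : StarKernel) (s t : ℝ) : (k * l).fn s t =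
    k.delta * l.fn s t + k.fn s t * l.delta + ∫ τ in t..s, k.fn s τ * l.fn τ t := rfl
@[simp] theorem fn_one (s t : ℝ) : (1 : StarKernel).fn s t = 0 := rfl
@[simp] theorem fn_zero (s t : ℝ) : (0 : StarKernel).fn s t = 0 := rfl
@[simp] theorem fn_add (k l : StarKernel) (s t : ℝ) : (k + l).fn s t = k.fn s t + l.fn s t := rfl
@[simp] theorem fn_sub (k l : StarKernel) (s t : ℝ) : (k - l).fn s t = k.fn s t - l.fn s t := rfl
@[simp] theorem fn_neg (k : StarKernel) (s t : ℝ) : (-k).fn s t = -k.fn s t := rfl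

/-- The function part of `k` is continuous on `I × I`. -/
def Regular (I : Set ℝ) (k : StarKernel) : Prop :=
  ContinuousOn (fun q : ℝ × ℝ => k.fn q.1 q.2) (I ×ˢ I)

theorem regular_zero : Regular I 0 := continuousOn_const
theorem regular_one : Regular I 1 := continuousOn_const

theorem Regular.add {k l : StarKernel} (hk : Regular I k) (hl : Regular I l) :
    Regular I (k + l) := ContinuousOn.add hk hl

theorem Regular.sub {k l : StarKernel} (hk : Regular I k) (hl : Regular I l) :
    Regular I (k - l) := ContinuousOn.sub hk hl

theorem Regular.neg {k : StarKernel} (hk : Regular I k) : Regular I (-k) := ContinuousOn.neg hk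

theorem Regular.sum {ι : Type*} {s : Finset ι} {k : ι → StarKernel}
    (hk : ∀ i ∈ s, Regular I (k i)) : Regular I (∑ i ∈ s, k i) := by
  classical
  induction s using Finset.induction_on with
  | empty => exact regular_zero
  | insert i s hi ih =>
    rw [Finset.sum_insert hi]
    exact (hk i (by simp)).add (ih fun j hj => hk j (by simp [hj]))

theorem Regular.mul (hI : I.OrdConnected) {k l : StarKernel} (hk : Regular I k)
    (hl : Regular I l) : Regular I (k * l) :=
  ((ContinuousOn.mul continuousOn_const hl).add (ContinuousOn.mul hk continuousOn_const)).add
    (continuousOn_convolution hI hk hl)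

/-! ### Equality of kernels on `I` -/

theorem EqOn.refl (k : StarKernel) : EqOn I k k := ⟨rfl, fun _ _ _ _ => rfl⟩

theorem EqOn.symm {k l : StarKernel} (h : EqOn I k l) : EqOn I l k :=
  ⟨h.1.symm, fun s hs t ht => (h.2 s hs t ht).symm⟩

theorem EqOn.trans {k l m : StarKernel} (h : EqOn I k l) (h' : EqOn I l m) : EqOn I k m :=
  ⟨h.1.trans h'.1, fun s hs t ht => (h.2 s hs t ht).trans (h'.2 s hs t ht)⟩

theorem EqOn.mul (hI : I.OrdConnected) {k k' l l' : StarKernel} (hk : EqOn I k k')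
    (hl : EqOn I l l') : EqOn I (k * l) (k' * l') := by
  refine ⟨by simp [hk.1, hl.1], fun s hs t ht => ?_⟩
  rw [fn_mul, fn_mul, hk.1, hl.1, hk.2 s hs t ht, hl.2 s hs t ht]
  congr 1
  refine intervalIntegral.integral_congr fun τ hτ => ?_
  have hτ' : τ ∈ I := hI.uIcc_subset ht hs hτ
  simp only [hk.2 s hs τ hτ', hl.2 τ hτ' t ht]

theorem EqOn.add {k k' l l' : StarKernel} (hk : EqOn I k k')
    (hl : EqOn I l l') : EqOn I (k + l) (k' + l') :=
  ⟨by simp [hk.1, hl.1], fun s hs t ht => by simp [hk.2 s hs t ht, hl.2 s hs t ht]⟩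

theorem EqOn.sub {k k' l l' : StarKernel} (hk : EqOn I k k')
    (hl : EqOn I l l') : EqOn I (k - l) (k' - l') :=
  ⟨by simp [hk.1, hl.1], fun s hs t ht => by simp [hk.2 s hs t ht, hl.2 s hs t ht]⟩

/-- Both sides integrate `k s σ * l σ τ * m τ t` over the triangle where `σ` lies between `τ` and
`s`. Fubini is applied to continuous extensions from the compact interval spanned by `s` and `t`. -/
theorem convolution_assoc (hI : I.OrdConnected) {k l m : ℝ → ℝ → ℂ}
    (hk : ContinuousOn (fun q : ℝ × ℝ => k q.1 q.2) (I ×ˢ I))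
    (hl : ContinuousOn (fun q : ℝ × ℝ => l q.1 q.2) (I ×ˢ I))
    (hm : ContinuousOn (fun q : ℝ × ℝ => m q.1 q.2) (I ×ˢ I))
    {s t : ℝ} (hs : s ∈ I) (ht : t ∈ I) :
    ∫ τ in t..s, (∫ σ in τ..s, k s σ * l σ τ) * m τ t =
      ∫ σ in t..s, k s σ * ∫ τ in t..σ, l σ τ * m τ t := by
  have hsub : Icc (min t s) (max t s) ⊆ I := hI.uIcc_subset ht hs
  have hab : min t s ≤ max t s := min_le_max
  have hs' : s ∈ Icc (min t s) (max t s) := right_mem_uIcc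
  have ht' : t ∈ Icc (min t s) (max t s) := left_mem_uIcc
  obtain ⟨k', hk', hkk⟩ := exists_continuous_eqOn_Icc hab (hk.mono (prod_mono hsub hsub))
  obtain ⟨l', hl', hll⟩ := exists_continuous_eqOn_Icc hab (hl.mono (prod_mono hsub hsub))
  obtain ⟨m', hm', hmm⟩ := exists_continuous_eqOn_Icc hab (hm.mono (prod_mono hsub hsub))
  have h := integral_triangle_swap (F := fun σ τ => k' s σ * l' σ τ * m' τ t)
    (((hk'.comp (f := fun q : ℝ × ℝ => (s, q.1)) (by fun_prop)).mul hl').mul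
      (hm'.comp (f := fun q : ℝ × ℝ => (q.2, t)) (by fun_prop))) t s
  convert h using 1
  · refine intervalIntegral.integral_congr fun τ hτ => ?_
    rw [← intervalIntegral.integral_mul_const]
    refine intervalIntegral.integral_congr fun σ hσ => ?_
    have hσ' := (ordConnected_uIcc (a := t) (b := s)).uIcc_subset hτ right_mem_uIcc hσ
    simp only [hkk s hs' σ hσ', hll σ hσ' τ hτ, hmm τ hτ t ht']
  · refine intervalIntegral.integral_congr fun σ hσ => ?_
    rw [← intervalIntegral.integral_const_mul]
    refine intervalIntegral.integral_congr fun τ hτ => ?_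
    have hτ' := (ordConnected_uIcc (a := t) (b := s)).uIcc_subset left_mem_uIcc hσ hτ
    simp only [hkk s hs' σ hσ, hll σ hσ τ hτ', hmm τ hτ' t ht', mul_assoc]

theorem mul_assoc_eqOn (hI : I.OrdConnected) {k l m : StarKernel} (hk : Regular I k)
    (hl : Regular I l) (hm : Regular I m) : EqOn I (k * l * m) (k * (l * m)) := by
  refine ⟨mul_assoc _ _ _, fun s hs t ht => ?_⟩
  have hkl := continuousOn_convolution hI hk hl
  have hlm := continuousOn_convolution hI hl hm
  have e1 : ∫ τ in t..s, (k * l).fn s τ * m.fn τ t =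
      k.delta * (∫ τ in t..s, l.fn s τ * m.fn τ t) + l.delta * (∫ τ in t..s, k.fn s τ * m.fn τ t) +
        ∫ τ in t..s, (∫ σ in τ..s, k.fn s σ * l.fn σ τ) * m.fn τ t := by
    rw [← intervalIntegral.integral_const_mul, ← intervalIntegral.integral_const_mul,
      ← intervalIntegral.integral_add, ← intervalIntegral.integral_add]
    · refine intervalIntegral.integral_congr fun τ _ => ?_
      simp only [fn_mul]; ring
    · exact ((intervalIntegrable_mul hI hl hm hs ht ht hs).const_mul _).add
        ((intervalIntegrable_mul hI hk hm hs ht ht hs).const_mul _)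
    · exact intervalIntegrable_mul hI (k := fun s τ => ∫ σ in τ..s, k.fn s σ * l.fn σ τ)
        hkl hm hs ht ht hs
    · exact (intervalIntegrable_mul hI hl hm hs ht ht hs).const_mul _
    · exact (intervalIntegrable_mul hI hk hm hs ht ht hs).const_mul _
  have e2 : ∫ τ in t..s, k.fn s τ * (l * m).fn τ t =
      l.delta * (∫ τ in t..s, k.fn s τ * m.fn τ t) + m.delta * (∫ τ in t..s, k.fn s τ * l.fn τ t) +
        ∫ σ in t..s, k.fn s σ * ∫ τ in t..σ, l.fn σ τ * m.fn τ t := by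
    rw [← intervalIntegral.integral_const_mul, ← intervalIntegral.integral_const_mul,
      ← intervalIntegral.integral_add, ← intervalIntegral.integral_add]
    · refine intervalIntegral.integral_congr fun τ _ => ?_
      simp only [fn_mul]; ring
    · exact ((intervalIntegrable_mul hI hk hm hs ht ht hs).const_mul _).add
        ((intervalIntegrable_mul hI hk hl hs ht ht hs).const_mul _)
    · exact intervalIntegrable_mul hI (l := fun σ t => ∫ τ in t..σ, l.fn σ τ * m.fn τ t)
        hk hlm hs ht ht hs
    · exact (intervalIntegrable_mul hI hk hm hs ht ht hs).const_mul _
    · exact (intervalIntegrable_mul hI hk hl hs ht ht hs).const_mul _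
  rw [fn_mul, fn_mul k (l * m), e1, e2, convolution_assoc hI hk hl hm hs ht, delta_mul, delta_mul,
    fn_mul, fn_mul]
  ring

theorem mul_add_eqOn (hI : I.OrdConnected) {k l m : StarKernel} (hk : Regular I k)
    (hl : Regular I l) (hm : Regular I m) : EqOn I (k * (l + m)) (k * l + k * m) := by
  refine ⟨mul_add _ _ _, fun s hs t ht => ?_⟩
  have e : ∫ τ in t..s, k.fn s τ * (l + m).fn τ t =
      (∫ τ in t..s, k.fn s τ * l.fn τ t) + ∫ τ in t..s, k.fn s τ * m.fn τ t := by
    rw [← intervalIntegral.integral_add (intervalIntegrable_mul hI hk hl hs ht ht hs)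
      (intervalIntegrable_mul hI hk hm hs ht ht hs)]
    refine intervalIntegral.integral_congr fun τ _ => ?_
    simp only [fn_add]; ring
  rw [fn_mul, e, fn_add, fn_add, delta_add, fn_mul, fn_mul]
  ring

theorem add_mul_eqOn (hI : I.OrdConnected) {k l m : StarKernel} (hk : Regular I k)
    (hl : Regular I l) (hm : Regular I m) : EqOn I ((k + l) * m) (k * m + l * m) := by
  refine ⟨add_mul _ _ _, fun s hs t ht => ?_⟩
  have e : ∫ τ in t..s, (k + l).fn s τ * m.fn τ t =
      (∫ τ in t..s, k.fn s τ * m.fn τ t) + ∫ τ in t..s, l.fn s τ * m.fn τ t := by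
    rw [← intervalIntegral.integral_add (intervalIntegrable_mul hI hk hm hs ht ht hs)
      (intervalIntegrable_mul hI hl hm hs ht ht hs)]
    refine intervalIntegral.integral_congr fun τ _ => ?_
    simp only [fn_add]; ring
  rw [fn_mul, e, fn_add, fn_add, delta_add, fn_mul, fn_mul]
  ring

theorem one_mul_eqOn (k : StarKernel) : EqOn I (1 * k) k :=
  ⟨one_mul _, fun s _ t _ => by simp [fn_mul]⟩

theorem mul_one_eqOn (k : StarKernel) : EqOn I (k * 1) k :=
  ⟨mul_one _, fun s _ t _ => by simp [fn_mul]⟩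

/-! ### The Volterra resolvent -/

/-- The iterated kernels `k, k * k, k * k * k, …` of an ordinary function `k`. -/
def iterKernel (k : ℝ → ℝ → ℂ) : ℕ → ℝ → ℝ → ℂ
  | 0 => k
  | n + 1 => fun s t => ∫ τ in t..s, k s τ * iterKernel k n τ t

theorem continuousOn_iterKernel (hI : I.OrdConnected) {k : ℝ → ℝ → ℂ}
    (hk : ContinuousOn (fun q : ℝ × ℝ => k q.1 q.2) (I ×ˢ I)) (n : ℕ) :
    ContinuousOn (fun q : ℝ × ℝ => iterKernel k n q.1 q.2) (I ×ˢ I) := by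
  induction n with
  | zero => exact hk
  | succ n ih => exact continuousOn_convolution hI hk ih

/-- Each convolution integrates `|τ - t| ^ n / n!` once more, which produces the factorial that
makes the series converge for kernels of any size. -/
theorem norm_iterKernel_le {a b M : ℝ} (hM : 0 ≤ M) {k : ℝ → ℝ → ℂ}
    (hk : ∀ s ∈ Icc a b, ∀ t ∈ Icc a b, ‖k s t‖ ≤ M) (n : ℕ) :
    ∀ s ∈ Icc a b, ∀ t ∈ Icc a b,
      ‖iterKernel k n s t‖ ≤ M ^ (n + 1) * (|s - t| ^ n / n.factorial) := by
  induction n with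
  | zero => intro s hs t ht; simpa [iterKernel] using hk s hs t ht
  | succ n ih =>
    intro s hs t ht
    have hint : IntegrableOn (fun τ => M * (M ^ (n + 1) * (|τ - t| ^ n / n.factorial)))
        (uIoc t s) := by
      have : Continuous fun τ => M * (M ^ (n + 1) * (|τ - t| ^ n / n.factorial)) := by fun_prop
      exact (this.continuousOn.integrableOn_compact isCompact_uIcc).mono_set uIoc_subset_uIcc
    calc ‖∫ τ in t..s, k s τ * iterKernel k n τ t‖
        = ‖∫ τ in uIoc t s, k s τ * iterKernel k n τ t‖ :=
          intervalIntegral.norm_intervalIntegral_eq _ _ _ _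
      _ ≤ ∫ τ in uIoc t s, M * (M ^ (n + 1) * (|τ - t| ^ n / n.factorial)) := by
          refine norm_integral_le_of_norm_le hint
            ((ae_restrict_iff' measurableSet_uIoc).2 (ae_of_all _ fun τ hτ => ?_))
          have hτ' : τ ∈ Icc a b := ordConnected_Icc.uIcc_subset ht hs (uIoc_subset_uIcc hτ)
          rw [norm_mul]
          exact mul_le_mul (hk s hs τ hτ') (ih τ hτ' t ht) (norm_nonneg _) hM
      _ = M ^ (n + 1 + 1) * (|s - t| ^ (n + 1) / (n + 1).factorial) := by
          rw [integral_const_mul, integral_const_mul, integral_div, integral_pow_abs_sub_uIoc,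
            Nat.factorial_succ]
          push_cast
          field_simp
          ring

/-- The sum of the iterated kernels. -/
def resolvent (k : ℝ → ℝ → ℂ) (s t : ℝ) : ℂ := ∑' n, iterKernel k n s t

theorem exists_summable_bound_iterKernel {a b : ℝ} {k : ℝ → ℝ → ℂ}
    (hk : ContinuousOn (fun q : ℝ × ℝ => k q.1 q.2) (Icc a b ×ˢ Icc a b)) :
    ∃ M : ℝ, 0 ≤ M ∧ (∀ s ∈ Icc a b, ∀ t ∈ Icc a b, ‖k s t‖ ≤ M) ∧ ∃ u : ℕ → ℝ, Summable u ∧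
      ∀ n, ∀ s ∈ Icc a b, ∀ t ∈ Icc a b, ‖iterKernel k n s t‖ ≤ u n := by
  obtain ⟨M₀, hM₀⟩ := (isCompact_Icc.prod isCompact_Icc).exists_bound_of_continuousOn hk
  have hM : ∀ s ∈ Icc a b, ∀ t ∈ Icc a b, ‖k s t‖ ≤ max M₀ 0 :=
    fun s hs t ht => (hM₀ (s, t) ⟨hs, ht⟩).trans (le_max_left _ _)
  refine ⟨max M₀ 0, le_max_right _ _, hM,
    fun n => max M₀ 0 * ((max M₀ 0 * (b - a)) ^ n / n.factorial),
    (Real.summable_pow_div_factorial _).mul_left _, fun n s hs t ht => ?_⟩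
  refine (norm_iterKernel_le (le_max_right _ _) hM n s hs t ht).trans ?_
  have : |s - t| ≤ b - a := abs_le.2 ⟨by linarith [hs.1, ht.2], by linarith [hs.2, ht.1]⟩
  calc max M₀ 0 ^ (n + 1) * (|s - t| ^ n / n.factorial)
      ≤ max M₀ 0 ^ (n + 1) * ((b - a) ^ n / n.factorial) := by gcongr
    _ = max M₀ 0 * ((max M₀ 0 * (b - a)) ^ n / n.factorial) := by rw [mul_pow]; ring

theorem continuousOn_resolvent (hI : I.OrdConnected) {k : ℝ → ℝ → ℂ}
    (hk : ContinuousOn (fun q : ℝ × ℝ => k q.1 q.2) (I ×ˢ I)) :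
    ContinuousOn (fun q : ℝ × ℝ => resolvent k q.1 q.2) (I ×ˢ I) := by
  refine continuousOn_prod_of_Icc fun a ha b hb hab => ?_
  have hsub : Icc a b ⊆ I := hI.out ha hb
  obtain ⟨-, -, -, u, hu, hbd⟩ :=
    exists_summable_bound_iterKernel (hk.mono (prod_mono hsub hsub))
  exact continuousOn_tsum (fun n => (continuousOn_iterKernel hI hk n).mono (prod_mono hsub hsub))
    hu fun n q hq => hbd n q.1 hq.1 q.2 hq.2

/-- Convolution with `k` shifts the series of iterated kernels by one index; dominated convergence
allows it to be done term by term. -/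
theorem resolvent_eq (hI : I.OrdConnected) {k : ℝ → ℝ → ℂ}
    (hk : ContinuousOn (fun q : ℝ × ℝ => k q.1 q.2) (I ×ˢ I)) {s t : ℝ} (hs : s ∈ I)
    (ht : t ∈ I) :
    resolvent k s t = k s t + ∫ τ in t..s, k s τ * resolvent k τ t := by
  have hsub : Icc (min t s) (max t s) ⊆ I := hI.uIcc_subset ht hs
  obtain ⟨M, hM0, hM, u, hu, hbd⟩ :=
    exists_summable_bound_iterKernel (hk.mono (prod_mono hsub hsub))
  have hsum : ∀ τ ∈ uIcc t s, Summable fun n => iterKernel k n τ t := fun τ hτ =>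
    Summable.of_norm_bounded hu fun n => hbd n τ hτ t left_mem_uIcc
  have h : HasSum (fun n => ∫ τ in t..s, k s τ * iterKernel k n τ t)
      (∫ τ in t..s, k s τ * resolvent k τ t) := by
    refine intervalIntegral.hasSum_integral_of_dominated_convergence (fun n _ => M * u n)
      (fun n => ?_) (fun n => ae_of_all _ fun τ hτ => ?_)
      (ae_of_all _ fun τ _ => hu.mul_left M) intervalIntegrable_const
      (ae_of_all _ fun τ hτ => ?_)
    · exact (intervalIntegrable_mul hI hk (continuousOn_iterKernel hI hk n)
        hs ht ht hs).aestronglyMeasurable_restrict_uIoc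
    · rw [norm_mul]
      exact mul_le_mul (hM s right_mem_uIcc τ (uIoc_subset_uIcc hτ))
        (hbd n τ (uIoc_subset_uIcc hτ) t left_mem_uIcc) (norm_nonneg _) hM0
    · exact (hsum τ (uIoc_subset_uIcc hτ)).hasSum.mul_left _
  rw [← h.tsum_eq, resolvent, (hsum s right_mem_uIcc).tsum_eq_zero_add]
  rfl

end StarKernel

namespace StarKernel

/-- The kernel `c • δ(s - t) + f(s, t)`. -/
def ofFn (c : ℂ) (f : ℝ → ℝ → ℂ) : StarKernel := (c, f)

@[simp] theorem delta_ofFn (c : ℂ) (f : ℝ → ℝ → ℂ) : (ofFn c f).delta = c := rfl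
@[simp] theorem fn_ofFn (c : ℂ) (f : ℝ → ℝ → ℂ) (s t : ℝ) : (ofFn c f).fn s t = f s t := rfl

end StarKernel

/-! ### The ring of kernels with continuous function part -/

/-- The kernels with continuous function part on `I × I`, normalized to vanish elsewhere. -/
def kernelSubgroup (I : Set ℝ) : AddSubgroup StarKernel where
  carrier := {k | k.Regular I ∧ ∀ s t, ¬(s ∈ I ∧ t ∈ I) → k.fn s t = 0}
  zero_mem' := ⟨StarKernel.regular_zero, fun _ _ _ => rfl⟩
  add_mem' := fun ha hb => ⟨ha.1.add hb.1, fun s t h => by simp [ha.2 s t h, hb.2 s t h]⟩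
  neg_mem' := fun ha => ⟨ha.1.neg, fun s t h => by simp [ha.2 s t h]⟩

/-- The kernels on `I × I` with continuous function part, as a type. -/
def KernelRing (I : Set ℝ) : Type := kernelSubgroup I

namespace KernelRing

open StarKernel

variable {I : Set ℝ}

instance : AddCommGroup (KernelRing I) := inferInstanceAs (AddCommGroup (kernelSubgroup I))

/-- The underlying kernel. -/
def toKernel (a : KernelRing I) : StarKernel := a.1

theorem regular_toKernel (a : KernelRing I) : a.toKernel.Regular I := a.2.1

@[simp] theorem toKernel_zero : (0 : KernelRing I).toKernel = 0 := rfl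

/-- Because elements vanish off `I × I`, equality on `I` is genuine equality, so identities valid
only on `I` become ring axioms. -/
theorem ext_of_eqOn {a b : KernelRing I} (h : EqOn I a.toKernel b.toKernel) : a = b := by
  refine Subtype.ext (Prod.ext h.1 (funext fun s => funext fun t => ?_))
  by_cases hst : s ∈ I ∧ t ∈ I
  · exact h.2 s hst.1 t hst.2
  · exact (a.2.2 s t hst).trans (b.2.2 s t hst).symm

open Classical in
theorem exists_toKernel_eqOn {k : StarKernel} (h : k.Regular I) :
    ∃ a : KernelRing I, EqOn I a.toKernel k :=
  ⟨⟨ofFn k.delta fun s t => if s ∈ I ∧ t ∈ I then k.fn s t else 0,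
    ContinuousOn.congr h fun _ hq => if_pos hq, fun _ _ hst => if_neg hst⟩,
    rfl, fun _ hs _ ht => if_pos ⟨hs, ht⟩⟩

open Classical in
/-- The element of the kernel ring given by a regular kernel. -/
def ofKernel (I : Set ℝ) (k : StarKernel) : KernelRing I :=
  if h : k.Regular I then (exists_toKernel_eqOn h).choose else 0

theorem toKernel_ofKernel {k : StarKernel} (h : k.Regular I) :
    EqOn I (ofKernel I k).toKernel k := by
  rw [ofKernel, dif_pos h]
  exact (exists_toKernel_eqOn h).choose_spec

theorem ofKernel_eq_iff {k : StarKernel} (h : k.Regular I) {a : KernelRing I} :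
    ofKernel I k = a ↔ EqOn I k a.toKernel :=
  ⟨fun e => e ▸ (toKernel_ofKernel h).symm, fun e => ext_of_eqOn ((toKernel_ofKernel h).trans e)⟩

theorem ofKernel_congr {k l : StarKernel} (hk : k.Regular I) (hl : l.Regular I) :
    ofKernel I k = ofKernel I l ↔ EqOn I k l := by
  rw [ofKernel_eq_iff hk]
  exact ⟨fun e => e.trans (toKernel_ofKernel hl), fun e => e.trans (toKernel_ofKernel hl).symm⟩

@[simp] theorem ofKernel_toKernel (a : KernelRing I) : ofKernel I a.toKernel = a :=
  (ofKernel_eq_iff a.regular_toKernel).2 (EqOn.refl _)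

instance : One (KernelRing I) := ⟨ofKernel I 1⟩

instance : Mul (KernelRing I) := ⟨fun a b => ofKernel I (a.toKernel * b.toKernel)⟩

theorem toKernel_one : EqOn I (1 : KernelRing I).toKernel 1 := toKernel_ofKernel regular_one

theorem ofKernel_one : ofKernel I 1 = 1 := rfl

theorem ofKernel_add {k l : StarKernel} (hk : k.Regular I) (hl : l.Regular I) :
    ofKernel I (k + l) = ofKernel I k + ofKernel I l :=
  (ofKernel_eq_iff (hk.add hl)).2 <|
    ((toKernel_ofKernel hk).symm.add (toKernel_ofKernel hl).symm)

theorem ofKernel_sub {k l : StarKernel} (hk : k.Regular I) (hl : l.Regular I) :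
    ofKernel I (k - l) = ofKernel I k - ofKernel I l :=
  (ofKernel_eq_iff (hk.sub hl)).2 <|
    ((toKernel_ofKernel hk).symm.sub (toKernel_ofKernel hl).symm)

theorem ofKernel_zero : ofKernel I 0 = 0 := (ofKernel_eq_iff regular_zero).2 (EqOn.refl _)

theorem ofKernel_sum {ι : Type*} {s : Finset ι} {k : ι → StarKernel}
    (hk : ∀ i ∈ s, (k i).Regular I) :
    ofKernel I (∑ i ∈ s, k i) = ∑ i ∈ s, ofKernel I (k i) := by
  classical
  induction s using Finset.induction_on with
  | empty => exact ofKernel_zero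
  | insert i s hi ih =>
    rw [Finset.sum_insert hi, Finset.sum_insert hi, ← ih fun j hj => hk j (by simp [hj])]
    exact ofKernel_add (hk i (by simp)) (Regular.sum fun j hj => hk j (by simp [hj]))

variable [hI : I.OrdConnected]

theorem toKernel_mul (a b : KernelRing I) : EqOn I (a * b).toKernel (a.toKernel * b.toKernel) :=
  toKernel_ofKernel (a.regular_toKernel.mul hI b.regular_toKernel)

instance : Ring (KernelRing I) where
  __ := (inferInstance : AddCommGroup (KernelRing I))
  mul_assoc a b c := ext_of_eqOn <|
    (toKernel_mul _ _).trans <| ((toKernel_mul a b).mul hI (EqOn.refl _)).trans <|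
    (mul_assoc_eqOn hI a.regular_toKernel b.regular_toKernel c.regular_toKernel).trans <|
    ((EqOn.refl _).mul hI (toKernel_mul b c).symm).trans (toKernel_mul _ _).symm
  one_mul a := ext_of_eqOn <| (toKernel_mul _ _).trans <|
    (toKernel_one.mul hI (EqOn.refl _)).trans (one_mul_eqOn _)
  mul_one a := ext_of_eqOn <| (toKernel_mul _ _).trans <|
    ((EqOn.refl _).mul hI toKernel_one).trans (mul_one_eqOn _)
  zero_mul a := ext_of_eqOn <| (toKernel_mul _ _).trans
    ⟨by simp, fun s _ t _ => by simp [fn_mul]⟩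
  mul_zero a := ext_of_eqOn <| (toKernel_mul _ _).trans
    ⟨by simp, fun s _ t _ => by simp [fn_mul]⟩
  left_distrib a b c := ext_of_eqOn <| (toKernel_mul _ _).trans <|
    (mul_add_eqOn hI a.regular_toKernel b.regular_toKernel c.regular_toKernel).trans
    ((toKernel_mul a b).add (toKernel_mul a c)).symm
  right_distrib a b c := ext_of_eqOn <| (toKernel_mul _ _).trans <|
    (add_mul_eqOn hI a.regular_toKernel b.regular_toKernel c.regular_toKernel).trans
    ((toKernel_mul a c).add (toKernel_mul b c)).symm

/-- The coefficient of the Dirac delta, as a ring homomorphism. -/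
def deltaHom (I : Set ℝ) [I.OrdConnected] : KernelRing I →+* ℂ where
  toFun a := a.toKernel.delta
  map_one' := toKernel_one.1
  map_mul' a b := (toKernel_mul a b).1
  map_zero' := rfl
  map_add' _ _ := rfl

theorem deltaHom_apply (a : KernelRing I) : deltaHom I a = a.toKernel.delta := rfl

theorem deltaHom_ofKernel {k : StarKernel} (hk : k.Regular I) :
    deltaHom I (ofKernel I k) = k.delta := (toKernel_ofKernel hk).1

theorem ofKernel_mul {k l : StarKernel} (hk : k.Regular I) (hl : l.Regular I) :
    ofKernel I (k * l) = ofKernel I k * ofKernel I l :=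
  (ofKernel_eq_iff (hk.mul hI hl)).2 <|
    ((toKernel_ofKernel hk).symm.mul hI (toKernel_ofKernel hl).symm).trans (toKernel_mul _ _).symm

/-- Write `a` as `1 - k` with `k` an ordinary function; the inverse is then `1` plus the resolvent
of `k`. -/
theorem exists_mul_eq_one (a : KernelRing I) (ha : deltaHom I a = 1) :
    ∃ b, a * b = 1 ∧ deltaHom I b = 1 := by
  have hk : ContinuousOn (fun q : ℝ × ℝ => -a.toKernel.fn q.1 q.2) (I ×ˢ I) :=
    a.regular_toKernel.neg
  set r := resolvent fun s t => -a.toKernel.fn s t with hr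
  have hreg : Regular I (ofFn 1 r) := continuousOn_resolvent hI hk
  refine ⟨ofKernel I (ofFn 1 r), ext_of_eqOn ?_, deltaHom_ofKernel hreg⟩
  refine (toKernel_mul _ _).trans <|
    ((EqOn.refl _).mul hI (toKernel_ofKernel hreg)).trans (EqOn.trans ?_ toKernel_one.symm)
  refine ⟨?_, fun s hs t ht => ?_⟩
  · rw [delta_mul, ← deltaHom_apply, ha]; simp
  · have h := resolvent_eq (k := fun s t => -a.toKernel.fn s t) hI hk hs ht
    rw [fn_mul, ← deltaHom_apply, ha]
    change 1 * r s t + a.toKernel.fn s t * 1 + ∫ τ in t..s, a.toKernel.fn s τ * r τ t = 0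
    have h' : r s t = -a.toKernel.fn s t + ∫ τ in t..s, -a.toKernel.fn s τ * r τ t := h
    simp only [neg_mul, intervalIntegral.integral_neg] at h'
    rw [h']; ring

theorem exists_inverse (a : KernelRing I) (ha : deltaHom I a = 1) :
    ∃ b, a * b = 1 ∧ b * a = 1 := by
  obtain ⟨b, hab, hb⟩ := exists_mul_eq_one a ha
  -- The right inverse `b` again has delta coefficient one, so it has a right inverse too, which
  -- must be `a`. No left-handed resolvent equation is needed.
  obtain ⟨c, hbc, -⟩ := exists_mul_eq_one b hb
  have : c = a := by rw [← one_mul c, ← hab, mul_assoc, hbc, mul_one]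
  exact ⟨b, hab, this ▸ hbc⟩

theorem isStarInverse_iff {k : StarKernel} (hk : k.Regular I) {g : StarKernel} :
    IsStarInverse I k g ↔
      g.Regular I ∧ ofKernel I k * ofKernel I g = 1 ∧ ofKernel I g * ofKernel I k = 1 := by
  refine and_congr_right fun (hg : g.Regular I) => ?_
  rw [← ofKernel_mul hk hg, ← ofKernel_mul hg hk, ← ofKernel_one,
    ofKernel_congr (hk.mul hI hg) regular_one, ofKernel_congr (hg.mul hI hk) regular_one]

theorem isStarInverse_starInv {k : StarKernel} (hk : k.Regular I) (h1 : k.delta = 1) :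
    IsStarInverse I k (starInv I k) := by
  have h : ∃ g, IsStarInverse I k g := by
    obtain ⟨b, hb⟩ := exists_inverse (ofKernel I k) ((deltaHom_ofKernel hk).trans h1)
    exact ⟨b.toKernel, (isStarInverse_iff hk).2 ⟨b.regular_toKernel, by simpa using hb⟩⟩
  rw [starInv, dif_pos h]
  exact h.choose_spec

theorem _root_.PathSum.StarKernel.IsStarInverse.unique {k g g' : StarKernel} (hk : k.Regular I)
    (hg : IsStarInverse I k g) (hg' : IsStarInverse I k g') : EqOn I g g' := by
  obtain ⟨hr, -, h⟩ := (isStarInverse_iff hk).1 hg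
  obtain ⟨hr', h', -⟩ := (isStarInverse_iff hk).1 hg'
  exact (ofKernel_congr hr hr').1 (left_inv_eq_right_inv h h')

end KernelRing

/-! ### Path sums in a ring -/

section Ring

variable {V : Type*}

theorem mem_simplePaths [Fintype V] {G : Digraph V} {W : Finset V} {α ω : V} {p : List V} :
    p ∈ simplePaths G W α ω ↔ IsSimplePath G W α ω p := by
  simp [simplePaths]

theorem mem_simpleCycles [Fintype V] {G : Digraph V} {W : Finset V} {α : V} {p : List V} :
    p ∈ simpleCycles G W α ↔ IsSimpleCycle G W α p := by
  simp [simpleCycles]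

theorem simplePaths_self [Fintype V] {G : Digraph V} {W : Finset V} {α : V} (hα : α ∈ W) :
    simplePaths G W α α = {[α]} := by
  ext p
  rw [mem_simplePaths, Finset.mem_singleton]
  constructor
  · rintro ⟨h1, h2, h3, -, -⟩
    match p with
    | [] => simp at h1
    | [a] => simpa using h1
    | a :: b :: q =>
      simp only [List.head?_cons, Option.some.injEq] at h1
      subst h1
      rw [List.getLast?_cons_cons] at h2
      exact absurd (List.mem_of_getLast? h2) (List.nodup_cons.1 h3).1
  · rintro rfl
    simp [IsSimplePath, hα]

variable [DecidableEq V] {A : Type*} [Ring A]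

/-- The weight of a path in a ring, for edge weights `E` and vertex weights `g`. -/
def ringPathWeight (E : V → V → A) (g : Finset V → V → A) : Finset V → List V → A
  | _, [] => 1
  | W, [ω] => g W ω
  | W, α :: ν :: p => ringPathWeight E g (W.erase α) (ν :: p) * E ν α * g W α

/-- The weight of a cycle in a ring, for edge weights `E` and vertex weights `g`. -/
def ringCycleWeight (E : V → V → A) (g : Finset V → V → A) (W : Finset V) (α : V) :
    List V → A
  | [] => E α α
  | μ₁ :: μ => E α ((μ₁ :: μ).getLast (List.cons_ne_nil μ₁ μ)) *
      ringPathWeight E g (W.erase α) (μ₁ :: μ) * E μ₁ α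

variable [Fintype V]

open Classical in
-- Peel off the first vertex: distinctness of the vertices is exactly the statement that the tail
-- avoids `α`.
theorem simplePaths_of_ne {G : Digraph V} {W : Finset V} {α ω : V} (hα : α ∈ W) (hω : ω ≠ α) :
    simplePaths G W α ω = ((W.erase α).filter (G.Adj α)).biUnion fun ν =>
      (simplePaths G (W.erase α) ν ω).image (List.cons α) := by
  ext p
  simp only [mem_simplePaths, Finset.mem_biUnion, Finset.mem_image, Finset.mem_filter]
  constructor
  · rintro ⟨h1, h2, h3, h4, h5⟩
    match p with
    | [] => simp at h1
    | [a] =>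
      simp only [List.head?_cons, List.getLast?_singleton, Option.some.injEq] at h1 h2
      exact absurd (h2.symm.trans h1) hω
    | a :: b :: q =>
      simp only [List.head?_cons, Option.some.injEq] at h1
      subst h1
      rw [List.getLast?_cons_cons] at h2
      rw [List.nodup_cons] at h3
      rw [List.isChain_cons_cons] at h5
      have hW : ∀ v ∈ b :: q, v ∈ W.erase a := fun v hv =>
        Finset.mem_erase.2 ⟨fun e => h3.1 (e ▸ hv), h4 v (List.mem_cons_of_mem _ hv)⟩
      exact ⟨b, ⟨hW b (by simp), h5.1⟩, b :: q, ⟨rfl, h2, h3.2, hW, h5.2⟩, rfl⟩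
  · rintro ⟨ν, ⟨hν, hadj⟩, q, ⟨h1, h2, h3, h4, h5⟩, rfl⟩
    match q with
    | [] => simp at h1
    | b :: q =>
      simp only [List.head?_cons, Option.some.injEq] at h1
      subst h1
      refine ⟨rfl, by rwa [List.getLast?_cons_cons], List.nodup_cons.2 ⟨fun h => ?_, h3⟩, ?_,
        List.isChain_cons_cons.2 ⟨hadj, h5⟩⟩
      · exact (Finset.mem_erase.1 (h4 _ h)).1 rfl
      · intro v hv
        rcases List.mem_cons.1 hv with rfl | hv
        · exact hα
        · exact (Finset.mem_erase.1 (h4 _ hv)).2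

open Classical in
theorem simpleCycles_eq {G : Digraph V} {W : Finset V} {α : V} (hα : α ∈ W) :
    simpleCycles G W α = (if G.Adj α α then {[]} else ∅) ∪
      (((W.erase α) ×ˢ (W.erase α)).filter fun q => G.Adj α q.1 ∧ G.Adj q.2 α).biUnion fun q =>
        simplePaths G (W.erase α) q.1 q.2 := by
  ext p
  simp only [mem_simpleCycles, Finset.mem_union, mem_simplePaths, Finset.mem_biUnion,
    Finset.mem_filter, Finset.mem_product]
  match p with
  | [] =>
    have : ∀ q : V × V, ¬IsSimplePath G (W.erase α) q.1 q.2 [] := fun q h => by simpa using h.1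
    simp only [this, and_false, exists_false, or_false]
    by_cases h : G.Adj α α <;> simp [IsSimpleCycle, h, hα]
  | b :: q =>
    have hne : ¬(b :: q ∈ if G.Adj α α then ({[]} : Finset (List V)) else ∅) := by
      split_ifs <;> simp
    simp only [hne, false_or]
    constructor
    · rintro ⟨h1, h2, h3, h4⟩
      have hW : ∀ v ∈ b :: q, v ∈ W.erase α := fun v hv =>
        Finset.mem_erase.2 ⟨fun e => h2 (e ▸ hv), h3 v (List.mem_cons_of_mem _ hv)⟩
      rw [List.cons_append, List.isChain_cons_cons, ← List.cons_append,
        List.isChain_append] at h4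
      have hl := List.getLast?_eq_some_getLast (List.cons_ne_nil b q)
      exact ⟨(b, (b :: q).getLast (List.cons_ne_nil b q)), ⟨⟨hW _ (by simp),
        hW _ (List.getLast_mem _)⟩, h4.1, h4.2.2.2 _ hl _ rfl⟩, rfl, hl, h1, hW, h4.2.1⟩
    · rintro ⟨⟨x, y⟩, ⟨-, hx, hy⟩, h1, h2, h3, h4, h5⟩
      simp only [List.head?_cons, Option.some.injEq] at h1
      subst h1
      refine ⟨h3, fun h => (Finset.mem_erase.1 (h4 _ h)).1 rfl, fun v hv => ?_, ?_⟩
      · rcases List.mem_cons.1 hv with rfl | hv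
        · exact hα
        · exact (Finset.mem_erase.1 (h4 _ hv)).2
      · rw [List.cons_append, List.isChain_cons_cons, ← List.cons_append, List.isChain_append]
        refine ⟨hx, h5, List.isChain_singleton _, fun a ha c hc => ?_⟩
        rw [h2] at ha
        simp only [Option.mem_def, Option.some.injEq, List.head?_cons] at ha hc
        subst ha hc
        exact hy

/-- The sum of the weights of the simple paths from `α` to `ω`. -/
def pathSum (G : Digraph V) (E : V → V → A) (g : Finset V → V → A) (W : Finset V) (ω α : V) : A :=
  ∑ p ∈ simplePaths G W α ω, ringPathWeight E g W p

variable {G : Digraph V} {E : V → V → A} {g : Finset V → V → A}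

theorem pathSum_self {W : Finset V} {α : V} (hα : α ∈ W) : pathSum G E g W α α = g W α := by
  simp [pathSum, simplePaths_self hα, ringPathWeight]

/-- The sum may run over all `ν`, not just the successors of `α`, since `E` vanishes on non-edges.
-/
theorem pathSum_of_ne (hE : ∀ α β, ¬G.Adj α β → E β α = 0) {W : Finset V} {α ω : V} (hα : α ∈ W)
    (hω : ω ≠ α) :
    pathSum G E g W ω α =
      ∑ ν ∈ W.erase α, pathSum G E g (W.erase α) ω ν * E ν α * g W α := by
  classical
  rw [pathSum, simplePaths_of_ne hα hω, Finset.sum_biUnion, Finset.sum_filter]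
  · refine Finset.sum_congr rfl fun ν _ => ?_
    split_ifs with h
    · rw [Finset.sum_image fun _ _ _ _ e => List.cons_injective e, pathSum, Finset.sum_mul,
        Finset.sum_mul]
      refine Finset.sum_congr rfl fun p hp => ?_
      have h1 := (mem_simplePaths.1 hp).1
      match p with
      | [] => simp at h1
      | b :: q =>
        simp only [List.head?_cons, Option.some.injEq] at h1
        subst h1
        rfl
    · rw [hE _ _ h]; simp
  · intro x _ y _ hxy
    refine Finset.disjoint_left.2 fun p hx hy => hxy ?_
    obtain ⟨p₁, h₁, e₁⟩ := Finset.mem_image.1 hx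
    obtain ⟨p₂, h₂, e₂⟩ := Finset.mem_image.1 hy
    have e := List.cons_injective (e₁.trans e₂.symm)
    subst e
    exact Option.some.inj ((mem_simplePaths.1 h₁).1.symm.trans (mem_simplePaths.1 h₂).1)

/-- Subtracted from `1`, the right-hand side is the Schur complement at `α`, once the path sums on
`W.erase α` are known to invert the remaining block. -/
theorem cycleSum_eq (hE : ∀ α β, ¬G.Adj α β → E β α = 0) {W : Finset V} {α : V} (hα : α ∈ W) :
    ∑ μ ∈ simpleCycles G W α, ringCycleWeight E g W α μ = E α α +
      ∑ ν ∈ W.erase α, ∑ κ ∈ W.erase α, E α κ * pathSum G E g (W.erase α) κ ν * E ν α := by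
  classical
  rw [simpleCycles_eq hα, Finset.sum_union, Finset.sum_biUnion, Finset.sum_filter,
    Finset.sum_product]
  · congr 1
    · split_ifs with h
      · simp [ringCycleWeight]
      · simp [hE _ _ h]
    · refine Finset.sum_congr rfl fun ν _ => Finset.sum_congr rfl fun κ _ => ?_
      simp only
      split_ifs with h
      · rw [pathSum, Finset.mul_sum, Finset.sum_mul]
        refine Finset.sum_congr rfl fun p hp => ?_
        obtain ⟨h1, h2, -⟩ := mem_simplePaths.1 hp
        match p with
        | [] => simp at h1
        | b :: q =>
          simp only [List.head?_cons, Option.some.injEq] at h1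
          subst h1
          rw [List.getLast?_eq_some_getLast (List.cons_ne_nil b q), Option.some.injEq] at h2
          rw [ringCycleWeight, h2]
      · rcases not_and_or.1 h with h | h <;> simp [hE _ _ h]
  · rintro ⟨x, y⟩ _ ⟨x', y'⟩ _ hxy
    refine Finset.disjoint_left.2 fun p hx hy => hxy ?_
    obtain ⟨h1, h2, -⟩ := mem_simplePaths.1 hx
    obtain ⟨h1', h2', -⟩ := mem_simplePaths.1 hy
    exact Prod.ext (Option.some.inj (h1.symm.trans h1')) (Option.some.inj (h2.symm.trans h2'))
  · refine Finset.disjoint_left.2 fun p hp hp' => ?_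
    obtain ⟨q, -, hq⟩ := Finset.mem_biUnion.1 hp'
    have h1 := (mem_simplePaths.1 hq).1
    split_ifs at hp
    · rw [Finset.mem_singleton.1 hp] at h1; simp at h1
    · simp at hp

/-- The matrix of path sums is a right inverse of the identity minus the matrix of edge weights. -/
theorem pathSum_eq_add_sum (hE : ∀ α β, ¬G.Adj α β → E β α = 0)
    (hg : ∀ (W : Finset V), ∀ α ∈ W,
      (1 - ∑ μ ∈ simpleCycles G W α, ringCycleWeight E g W α μ) * g W α = 1)
    (W : Finset V) : ∀ α ∈ W, ∀ ω ∈ W, pathSum G E g W ω α =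
      (if ω = α then 1 else 0) + ∑ ν ∈ W, E ω ν * pathSum G E g W ν α := by
  induction W using Finset.strongInduction with
  | H W ih =>
  intro α hα ω hω
  -- Separate the term `ν = α`, and in the others peel the first vertex off each path from `α` to
  -- `ν`.
  have key : ∀ ω, ∑ ν ∈ W, E ω ν * pathSum G E g W ν α = E ω α * g W α +
      ∑ κ ∈ W.erase α, (∑ ν ∈ W.erase α, E ω ν * pathSum G E g (W.erase α) ν κ) * E κ α *
        g W α := by
    intro ω
    rw [← Finset.add_sum_erase _ _ hα, pathSum_self hα]
    congr 1
    simp_rw [Finset.sum_mul]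
    rw [Finset.sum_comm]
    refine Finset.sum_congr rfl fun ν hν => ?_
    rw [pathSum_of_ne hE hα (Finset.ne_of_mem_erase hν), Finset.mul_sum]
    exact Finset.sum_congr rfl fun κ _ => by simp only [mul_assoc]
  rw [key]
  -- On the diagonal the claim is the defining equation of `g W α`. Off it, the induction hypothesis
  -- on `W.erase α` applies, and its identity term supplies `E ω α * g W α`.
  by_cases h : ω = α
  · subst h
    have h1 := hg W ω hα
    rw [cycleSum_eq hE hα, sub_mul, one_mul, sub_eq_iff_eq_add, add_mul] at h1
    rw [pathSum_self hα, if_pos rfl]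
    refine h1.trans ?_
    simp_rw [Finset.sum_mul]
  · rw [if_neg h, zero_add, pathSum_of_ne hE hα h]
    have hω' : ω ∈ W.erase α := Finset.mem_erase.2 ⟨h, hω⟩
    have hrec : ∀ κ ∈ W.erase α, pathSum G E g (W.erase α) ω κ * E κ α * g W α =
        (if ω = κ then E κ α * g W α else 0) +
        (∑ ν ∈ W.erase α, E ω ν * pathSum G E g (W.erase α) ν κ) * E κ α * g W α := by
      intro κ hκ
      rw [ih _ (Finset.erase_ssubset hα) κ hκ ω hω', add_mul, add_mul]
      congr 1
      split_ifs <;> simp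
    rw [Finset.sum_congr rfl hrec, Finset.sum_add_distrib, Finset.sum_ite_eq, if_pos hω']

end Ring

open StarKernel KernelRing

/-! ### Regularity of the Green kernels -/

namespace StarKernel

theorem delta_sum {ι : Type*} (s : Finset ι) (k : ι → StarKernel) :
    (∑ i ∈ s, k i).delta = ∑ i ∈ s, (k i).delta := by
  classical
  induction s using Finset.induction_on with
  | empty => simp
  | insert i s hi ih => rw [Finset.sum_insert hi, Finset.sum_insert hi, delta_add, ih]

end StarKernel

section Green

variable {V : Type*} {I : Set ℝ} {H : ℝ → Matrix V V ℂ}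

@[simp] theorem delta_edge (β α : V) : (edge H β α).delta = 0 := rfl

theorem continuousOn_entry (hH : ContinuousOn H I) (i j : V) :
    ContinuousOn (fun t => H t i j) I :=
  (continuous_id.matrix_elem i j).comp_continuousOn hH

theorem regular_edge (hH : ContinuousOn H I) (β α : V) : (edge H β α).Regular I :=
  (continuousOn_entry hH β α).comp (f := fun q : ℝ × ℝ => q.2) continuous_snd.continuousOn
    fun _ hq => hq.2

theorem ofKernel_edge_of_not_adj (hH : ContinuousOn H I) (α β : V) (h : ¬(graph I H).Adj α β) :
    ofKernel I (edge H β α) = 0 := by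
  refine (ofKernel_eq_iff (regular_edge hH β α)).2 ⟨rfl, fun s _ t ht => ?_⟩
  by_contra hne
  exact h ⟨t, ht, hne⟩

variable [DecidableEq V] {g g' : Finset V → V → StarKernel}

theorem pathWeight_congr (p : List V) : ∀ {W : Finset V},
    (∀ W₁ ⊆ W, ∀ β, g W₁ β = g' W₁ β) → pathWeight H g W p = pathWeight H g' W p := by
  induction p with
  | nil => intro W _; rfl
  | cons α p ih =>
    intro W h
    match p with
    | [] => exact h W subset_rfl α
    | ν :: p =>
      rw [pathWeight, pathWeight, h W subset_rfl α,
        ih fun W₁ h₁ => h W₁ (h₁.trans (Finset.erase_subset _ _))]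

theorem delta_cycleWeight (W : Finset V) (α : V) (μ : List V) :
    (cycleWeight H g W α μ).delta = 0 := by
  cases μ <;> simp [cycleWeight]

theorem greenDenom_congr [Fintype V] {W : Finset V} (h : ∀ W₁ ⊂ W, ∀ β, g W₁ β = g' W₁ β) (α : V) :
    greenDenom I H g W α = greenDenom I H g' W α := by
  unfold greenDenom
  congr 1
  refine Finset.sum_congr rfl fun μ hμ => ?_
  -- A cycle can exist only if `α ∈ W`, so its weight involves proper subsets of `W` only; otherwise
  -- the sum is empty.
  have hα : α ∈ W := (mem_simpleCycles.1 hμ).2.2.1 α (by simp)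
  cases μ with
  | nil => rfl
  | cons ν μ =>
    rw [cycleWeight, cycleWeight, pathWeight_congr (g' := g') (ν :: μ) fun W₁ h₁ =>
      h W₁ (h₁.trans_ssubset (Finset.erase_ssubset hα))]

/-- Every cycle weight contains an edge kernel, which has no delta part. This normalization is what
guarantees the star inverse. -/
theorem delta_greenDenom [Fintype V] (W : Finset V) (α : V) : (greenDenom I H g W α).delta = 1 := by
  simp [greenDenom, delta_sum, delta_cycleWeight]

variable [hI : I.OrdConnected]

theorem regular_pathWeight (hH : ContinuousOn H I) (hg : ∀ W α, (g W α).Regular I) (p : List V) :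
    ∀ W, (pathWeight H g W p).Regular I := by
  induction p with
  | nil => intro W; exact regular_one
  | cons α p ih =>
    intro W
    match p with
    | [] => exact hg W α
    | ν :: p => exact Regular.mul hI (Regular.mul hI (ih _) (regular_edge hH ν α)) (hg W α)

theorem regular_cycleWeight (hH : ContinuousOn H I) (hg : ∀ W α, (g W α).Regular I) (W : Finset V)
    (α : V) (μ : List V) : (cycleWeight H g W α μ).Regular I := by
  cases μ with
  | nil => exact regular_edge hH α α
  | cons ν μ =>
    exact Regular.mul hI (Regular.mul hI (regular_edge hH _ _) (regular_pathWeight hH hg _ _))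
      (regular_edge hH _ _)

theorem ofKernel_pathWeight (hH : ContinuousOn H I) (hg : ∀ W α, (g W α).Regular I)
    (p : List V) : ∀ W, ofKernel I (pathWeight H g W p) =
      ringPathWeight (fun β α => ofKernel I (edge H β α)) (fun W α => ofKernel I (g W α)) W p := by
  induction p with
  | nil => intro W; rfl
  | cons α p ih =>
    intro W
    match p with
    | [] => rfl
    | ν :: p =>
      have h := regular_pathWeight hH hg (ν :: p) (W.erase α)
      rw [pathWeight, ofKernel_mul (h.mul hI (regular_edge hH ν α)) (hg W α),
        ofKernel_mul h (regular_edge hH ν α), ih, ringPathWeight]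

theorem ofKernel_cycleWeight (hH : ContinuousOn H I) (hg : ∀ W α, (g W α).Regular I)
    (W : Finset V) (α : V) (μ : List V) : ofKernel I (cycleWeight H g W α μ) =
      ringCycleWeight (fun β α => ofKernel I (edge H β α)) (fun W α => ofKernel I (g W α))
        W α μ := by
  cases μ with
  | nil => rfl
  | cons ν μ =>
    have h := regular_pathWeight hH hg (ν :: μ) (W.erase α)
    rw [cycleWeight, ofKernel_mul ((regular_edge hH _ _).mul hI h) (regular_edge hH _ _),
      ofKernel_mul (regular_edge hH _ _) h, ofKernel_pathWeight hH hg, ringCycleWeight]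

variable [Fintype V]

theorem regular_greenDenom (hH : ContinuousOn H I) (hg : ∀ W α, (g W α).Regular I)
    (W : Finset V) (α : V) : (greenDenom I H g W α).Regular I :=
  regular_one.sub (Regular.sum fun μ _ => regular_cycleWeight hH hg W α μ)

/-- Existence and regularity propagate together: regular kernels on smaller sets make the
denominator regular, hence invertible with a regular inverse. -/
theorem regular_green (hH : ContinuousOn H I) (W : Finset V) :
    ∀ α, (green I H W α).Regular I := by
  induction W using Finset.strongInduction with
  | H W ih =>
    intro α
    rw [green]
    refine (isStarInverse_starInv (regular_greenDenom hH (fun W₁ β => ?_) W α)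
      (delta_greenDenom W α)).1
    split_ifs with h
    · exact ih W₁ h β
    · exact regular_zero

theorem isStarInverse_green (hH : ContinuousOn H I) (W : Finset V) (α : V) :
    IsStarInverse I (greenDenom I H (green I H) W α) (green I H W α) := by
  have h : greenDenom I H (fun W₁ β => if _ : W₁ ⊂ W then green I H W₁ β else 0) W α =
      greenDenom I H (green I H) W α :=
    greenDenom_congr (fun W₁ h₁ β => by rw [dif_pos h₁]) α
  have h' : green I H W α = starInv I (greenDenom I H (green I H) W α) := by rw [green, h]
  exact h' ▸ isStarInverse_starInv (regular_greenDenom hH (regular_green hH) W α)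
    (delta_greenDenom W α)

/-- The path sums of the Green kernels on the whole graph, as elements of the kernel ring. -/
def resolventEntry (I : Set ℝ) [I.OrdConnected] (H : ℝ → Matrix V V ℂ) (ω α : V) : KernelRing I :=
  pathSum (graph I H) (fun β α => ofKernel I (edge H β α))
    (fun W α => ofKernel I (green I H W α)) Finset.univ ω α

theorem resolventEntry_eq (hH : ContinuousOn H I) (ω α : V) :
    resolventEntry I H ω α = (if ω = α then 1 else 0) +
      ∑ ν, ofKernel I (edge H ω ν) * resolventEntry I H ν α := by
  refine pathSum_eq_add_sum (ofKernel_edge_of_not_adj hH) (fun W α _ => ?_) Finset.univ α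
    (Finset.mem_univ _) ω (Finset.mem_univ _)
  have hg := regular_green (I := I) hH
  -- Only the right-inverse half is needed for the path-sum identity.
  have h := ((isStarInverse_iff (regular_greenDenom hH hg W α)).1
    (isStarInverse_green hH W α)).2.1
  rw [greenDenom, ofKernel_sub regular_one
    (Regular.sum fun μ _ => regular_cycleWeight hH hg W α μ), ofKernel_one,
    ofKernel_sum fun μ _ => regular_cycleWeight hH hg W α μ] at h
  simpa only [ofKernel_cycleWeight hH hg] using h

end Green

/-! ### The time-ordered exponential -/

namespace KernelRing

variable {I : Set ℝ}

/-- Evaluation of the function part. -/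
def evalHom (I : Set ℝ) (s t : ℝ) : KernelRing I →+ ℂ where
  toFun a := a.toKernel.fn s t
  map_zero' := rfl
  map_add' _ _ := rfl

theorem evalHom_ofKernel {k : StarKernel} (hk : k.Regular I) {s t : ℝ} (hs : s ∈ I) (ht : t ∈ I) :
    evalHom I s t (ofKernel I k) = k.fn s t := (toKernel_ofKernel hk).2 s hs t ht

/-- The kernel with constant value one (the Heaviside function for `t ≤ s`). -/
def theta (I : Set ℝ) : KernelRing I := ofKernel I (ofFn 0 fun _ _ => 1)

theorem regular_const (c : ℂ) : (ofFn 0 fun _ _ => c).Regular I := continuousOn_const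

theorem evalHom_theta {s t : ℝ} (hs : s ∈ I) (ht : t ∈ I) : evalHom I s t (theta I) = 1 :=
  evalHom_ofKernel (regular_const 1) hs ht

variable [hI : I.OrdConnected]

theorem deltaHom_theta : deltaHom I (theta I) = 0 := deltaHom_ofKernel (regular_const 1)

/-- Integration is star multiplication by the constant `1`; the delta part contributes its
coefficient, matching the end-point convention in `StarKernel.integral`. -/
theorem evalHom_ofKernel_mul_theta {k : StarKernel} (hk : k.Regular I) {s t : ℝ} (hs : s ∈ I)
    (ht : t ∈ I) : evalHom I s t (ofKernel I k * theta I) = k.integral s t := by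
  rw [theta, ← ofKernel_mul hk (regular_const 1), evalHom_ofKernel (hk.mul hI (regular_const 1))
    hs ht, fn_mul]
  simp [StarKernel.integral]

end KernelRing

/-! ### Uniqueness for the linear equation, and the path sums as its solution -/

section Exponential

variable {V : Type*} [Fintype V] {I : Set ℝ} {H : ℝ → Matrix V V ℂ}

theorem hasDerivWithinAt_integral (hI : I.OrdConnected) {f : ℝ → ℂ} (hf : ContinuousOn f I)
    {s t : ℝ} (hs : s ∈ I) (ht : t ∈ I) :
    HasDerivWithinAt (fun r => ∫ τ in t..r, f τ) (f s) I s := by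
  obtain ⟨a, ha, b, hb, has, hsb, hn⟩ := exists_Icc_mem_nhdsWithin hs
  have hc : ContinuousOn f (Icc a b) := hf.mono (hI.out ha hb)
  have : Fact (s ∈ Icc a b) := ⟨has, hsb⟩
  exact (intervalIntegral.integral_hasDerivWithinAt_right
    (hf.mono (hI.uIcc_subset ht hs)).intervalIntegrable
    (hc.stronglyMeasurableAtFilter_nhdsWithin measurableSet_Icc s)
    (hc s ⟨has, hsb⟩) : HasDerivWithinAt _ _ (Icc a b) s).mono_of_mem_nhdsWithin hn

theorem exists_lipschitzOnWith_mulVec (hI : I.OrdConnected) (hH : ContinuousOn H I) {a b : ℝ}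
    (ha : a ∈ I) (hb : b ∈ I) :
    ∃ K : NNReal, ∀ r ∈ Icc a b, LipschitzOnWith K (fun x : V → ℂ => H r *ᵥ x) univ := by
  have hc : ContinuousOn (fun r => ∑ i, ∑ j, ‖H r i j‖) (Icc a b) :=
    continuousOn_finsetSum _ fun i _ => continuousOn_finsetSum _ fun j _ =>
      ((continuousOn_entry hH i j).mono (hI.out ha hb)).norm
  obtain ⟨M, hM⟩ := isCompact_Icc.exists_bound_of_continuousOn hc
  refine ⟨M.toNNReal, fun r hr => (LipschitzWith.of_dist_le_mul fun x y => ?_).lipschitzOnWith⟩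
  have hr' : ∑ i, ∑ j, ‖H r i j‖ ≤ M.toNNReal :=
    (le_abs_self _).trans ((hM r hr).trans (Real.le_coe_toNNReal M))
  rw [dist_eq_norm, dist_eq_norm, ← Matrix.mulVec_sub]
  refine (pi_norm_le_iff_of_nonneg (by positivity)).2 fun i => ?_
  calc ‖∑ j, H r i j * (x - y) j‖ ≤ ∑ j, ‖H r i j * (x - y) j‖ := norm_sum_le _ _
    _ ≤ ∑ j, ‖H r i j‖ * ‖x - y‖ := by
        refine Finset.sum_le_sum fun j _ => ?_
        rw [norm_mul]
        exact mul_le_mul_of_nonneg_left (norm_le_pi_norm _ j) (norm_nonneg _)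
    _ = (∑ j, ‖H r i j‖) * ‖x - y‖ := (Finset.sum_mul _ _ _).symm
    _ ≤ M.toNNReal * ‖x - y‖ := by
        refine mul_le_mul_of_nonneg_right (le_trans ?_ hr') (norm_nonneg _)
        exact Finset.single_le_sum (f := fun i => ∑ j, ‖H r i j‖)
          (fun i _ => Finset.sum_nonneg fun j _ => norm_nonneg _) (Finset.mem_univ i)

variable [DecidableEq V]

theorem IsTimeOrderedExp.hasDerivWithinAt_col {U : ℝ → ℝ → Matrix V V ℂ}
    (hU : IsTimeOrderedExp I H U) {s t : ℝ} (hs : s ∈ I) (ht : t ∈ I) (j : V) :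
    HasDerivWithinAt (fun r i => U r t i j) (H s *ᵥ fun i => U s t i j) I s :=
  hasDerivWithinAt_pi.2 fun i => (hU t ht).2 s hs i j

/-- Each column solves a linear equation whose Lipschitz constant is uniform between `s` and `t`.
Both directions of time are treated, as `s` may precede `t`. -/
theorem IsTimeOrderedExp.unique (hI : I.OrdConnected) (hH : ContinuousOn H I)
    {U U' : ℝ → ℝ → Matrix V V ℂ} (hU : IsTimeOrderedExp I H U) (hU' : IsTimeOrderedExp I H U')
    {s t : ℝ} (hs : s ∈ I) (ht : t ∈ I) : U s t = U' s t := by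
  suffices h : ∀ j, (fun i => U s t i j) = fun i => U' s t i j from
    Matrix.ext fun i j => congrFun (h j) i
  intro j
  have hc : ∀ {U : ℝ → ℝ → Matrix V V ℂ}, IsTimeOrderedExp I H U →
      ContinuousOn (fun r i => U r t i j) I :=
    fun hU r hr => (hU.hasDerivWithinAt_col hr ht j).continuousWithinAt
  have h0 : (fun i => U t t i j) = fun i => U' t t i j := by rw [(hU t ht).1, (hU' t ht).1]
  rcases le_total t s with hts | hst
  · obtain ⟨K, hK⟩ := exists_lipschitzOnWith_mulVec hI hH ht hs
    have hsub : Icc t s ⊆ I := hI.out ht hs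
    have hd : ∀ {U : ℝ → ℝ → Matrix V V ℂ}, IsTimeOrderedExp I H U → ∀ r ∈ Ico t s,
        HasDerivWithinAt (fun r i => U r t i j) (H r *ᵥ fun i => U r t i j) (Ici r) r :=
      fun hU r hr => (hU.hasDerivWithinAt_col (hsub (Ico_subset_Icc_self hr)) ht
        j).mono_of_mem_nhdsWithin (mem_of_superset (Icc_mem_nhdsGE hr.2)
          (hI.out (hsub (Ico_subset_Icc_self hr)) hs))
    exact ODE_solution_unique_of_mem_Icc_right (v := fun r x => H r *ᵥ x) (s := fun _ => univ)
      (fun r hr => hK r (Ico_subset_Icc_self hr)) ((hc hU).mono hsub) (hd hU)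
      (fun _ _ => mem_univ _) ((hc hU').mono hsub) (hd hU') (fun _ _ => mem_univ _) h0
      (right_mem_Icc.2 hts)
  · obtain ⟨K, hK⟩ := exists_lipschitzOnWith_mulVec hI hH hs ht
    have hsub : Icc s t ⊆ I := hI.out hs ht
    have hd : ∀ {U : ℝ → ℝ → Matrix V V ℂ}, IsTimeOrderedExp I H U → ∀ r ∈ Ioc s t,
        HasDerivWithinAt (fun r i => U r t i j) (H r *ᵥ fun i => U r t i j) (Iic r) r :=
      fun hU r hr => (hU.hasDerivWithinAt_col (hsub (Ioc_subset_Icc_self hr)) ht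
        j).mono_of_mem_nhdsWithin (mem_of_superset (Icc_mem_nhdsLE hr.1)
          (hI.out hs (hsub (Ioc_subset_Icc_self hr))))
    exact ODE_solution_unique_of_mem_Icc_left (v := fun r x => H r *ᵥ x) (s := fun _ => univ)
      (fun r hr => hK r (Ioc_subset_Icc_self hr)) ((hc hU).mono hsub) (hd hU)
      (fun _ _ => mem_univ _) ((hc hU').mono hsub) (hd hU') (fun _ _ => mem_univ _) h0
      (left_mem_Icc.2 hst)

/-- The matrix of integrated path sums. -/
def pathSumExp (I : Set ℝ) [I.OrdConnected] (H : ℝ → Matrix V V ℂ) (s t : ℝ) : Matrix V V ℂ :=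
  Matrix.of fun ω α => evalHom I s t (resolventEntry I H ω α * theta I)

variable [hI : I.OrdConnected]

theorem pathSumExp_apply (hH : ContinuousOn H I) {s t : ℝ} (hs : s ∈ I) (ht : t ∈ I) (α ω : V) :
    pathSumExp I H s t ω α = ∑ p ∈ simplePaths (graph I H) Finset.univ α ω,
      (pathWeight H (green I H) Finset.univ p).integral s t := by
  have hg := regular_green (I := I) hH
  rw [pathSumExp, Matrix.of_apply, resolventEntry, pathSum, Finset.sum_mul, map_sum]
  refine Finset.sum_congr rfl fun p _ => ?_
  rw [← ofKernel_pathWeight hH hg,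
    evalHom_ofKernel_mul_theta (regular_pathWeight hH hg p _) hs ht]

/-- This is `R * theta = theta + E * R * theta`, evaluated entrywise at `(s, t)`. -/
theorem pathSumExp_eq_integral (hH : ContinuousOn H I) {s t : ℝ} (hs : s ∈ I) (ht : t ∈ I)
    (ω α : V) : pathSumExp I H s t ω α = (1 : Matrix V V ℂ) ω α +
      ∑ ν, ∫ τ in t..s, H τ ω ν * pathSumExp I H τ t ν α := by
  rw [pathSumExp, Matrix.of_apply, resolventEntry_eq hH, add_mul, Finset.sum_mul, map_add, map_sum]
  congr 1
  · rw [Matrix.one_apply]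
    split_ifs
    · rw [one_mul, evalHom_theta hs ht]
    · rw [zero_mul, map_zero]
  · refine Finset.sum_congr rfl fun ν _ => ?_
    have hr := regular_edge (I := I) hH ω ν
    set y := resolventEntry I H ν α * theta I with hy
    -- Neither the edge kernel nor `y` has a delta part, so their product is a pure integral.
    have hd : y.toKernel.delta = 0 := by
      rw [← deltaHom_apply, hy, map_mul, deltaHom_theta, mul_zero]
    rw [mul_assoc, ← hy, ← ofKernel_toKernel y, ← ofKernel_mul hr y.regular_toKernel,
      evalHom_ofKernel (hr.mul hI y.regular_toKernel) hs ht, fn_mul, hd, delta_edge, zero_mul,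
      mul_zero, zero_add, zero_add]
    rfl

theorem isTimeOrderedExp_pathSumExp (hH : ContinuousOn H I) :
    IsTimeOrderedExp I H (pathSumExp I H) := by
  refine fun t ht => ⟨?_, fun s hs ω α => ?_⟩
  · ext ω α
    simp [pathSumExp_eq_integral hH ht ht]
  · have hc : ∀ ν, ContinuousOn (fun τ => H τ ω ν * pathSumExp I H τ t ν α) I := fun ν =>
      (continuousOn_entry hH ω ν).mul <|
        (resolventEntry I H ν α * theta I).regular_toKernel.comp (f := fun τ : ℝ => (τ, t))
          (by fun_prop) fun τ hτ => ⟨hτ, ht⟩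
    have h := (HasDerivWithinAt.fun_sum (u := Finset.univ) fun ν _ =>
      hasDerivWithinAt_integral hI (hc ν) hs ht).const_add ((1 : Matrix V V ℂ) ω α)
    rw [Matrix.mul_apply]
    exact h.congr (fun r hr => pathSumExp_eq_integral hH hr ht ω α)
      (pathSumExp_eq_integral hH hs ht ω α)

end Exponential

end PathSum

end

theorem theorem4p1 {V : Type*} [Fintype V] [DecidableEq V] (I : Set ℝ) (hI : I.OrdConnected)
    (H : ℝ → Matrix V V ℂ) (hH : ContinuousOn H I) :
    -- the time-ordered exponential exists
    (∃ U, PathSum.IsTimeOrderedExp I H U) ∧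
    -- each Green kernel is the star inverse of one minus the finite sum over simple cycles,
    -- formed with the Green kernels of vertex-deleted subgraphs
    (∀ (W : Finset V), ∀ α ∈ W,
      PathSum.StarKernel.IsStarInverse I
        (1 - ∑ μ ∈ PathSum.simpleCycles (PathSum.graph I H) W α,
          PathSum.cycleWeight H (PathSum.green I H) W α μ)
        (PathSum.green I H W α) ∧
      ∀ g, PathSum.StarKernel.IsStarInverse I
        (1 - ∑ μ ∈ PathSum.simpleCycles (PathSum.graph I H) W α,
          PathSum.cycleWeight H (PathSum.green I H) W α μ) g →
        PathSum.StarKernel.EqOn I g (PathSum.green I H W α)) ∧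
    -- the path-sum formula
    (∀ U, PathSum.IsTimeOrderedExp I H U → ∀ s ∈ I, ∀ t ∈ I, ∀ α ω : V,
      U s t ω α =
        ∑ p ∈ PathSum.simplePaths (PathSum.graph I H) Finset.univ α ω,
          (PathSum.pathWeight H (PathSum.green I H) Finset.univ p).integral s t) := by
  have := hI
  refine ⟨⟨_, PathSum.isTimeOrderedExp_pathSumExp hH⟩, fun W α _ => ?_, fun U hU s hs t ht α ω => ?_⟩
  · have h := PathSum.isStarInverse_green hH W α
    exact ⟨h, fun g hg => hg.unique (PathSum.regular_greenDenom hH (PathSum.regular_green hH) W α) h⟩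
  · rw [← PathSum.pathSumExp_apply hH hs ht,
      hU.unique hI hH (PathSum.isTimeOrderedExp_pathSumExp hH) hs ht]
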